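/- **Theorem.** Let $q\in(0,1)$, $a\neq 0$, $b<0$, $|b|>|a|$, and put $\kappa:=-\log|b/a|/\log(1/q)$. Let $f\in C([0,\infty);\mathbb R)$ and $\zeta\in\mathbb R$, let $x$ be the solution of $$x'(t)=ax(qt)+bx(t)+f(t),\quad t\ge 0;\qquad x(0)=\zeta,$$ and let $y$ be the solution of $y'(t)=-y(t)+f(t)$, $t\ge 0$, $y(0)=0$. For $t\ge 0$ and $\theta\in[0,1]$ let $f_\theta(t):=\int_{(t-\theta)^+}^t f(s)\,ds$. Suppose that either (i) $\gamma:[0,\infty)\to(0,\infty)$ is measurable and regularly varying at infinity with some index $\eta>\kappa$, i.e. $\lim_{t\to\infty}\gamma(\lambda t)/\gamma(t)=\lambda^\eta$ for all $\lambda>0$; or (ii) $\gamma:[0,\infty)\to(0,\infty)$ is non-decreasing and $C^1$, with $\gamma(t)\to\infty$ as $t\to\infty$. Consider the conditions (A) there are $K>0$ and $T\ge 0$ such that $\sup_{0\le\theta\le1}|f_\theta(t)|\le K\gamma(t)$ for all $t\ge T$; (A$_0$) for each $\theta\in[0,1]$, $f_\theta(t)=o(\gamma(t))$ as $t\to\infty$;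 (A$_+$) there is $\theta'\in(0,1]$ such that $\limsup_{t\to\infty}|f_{\theta'}(t)|/\gamma(t)>0$. Then: (I) (A) $\iff$ $y(t)=O(\gamma(t))$ as $t\to\infty$ $\iff$ $x(t)=O(\gamma(t))$ as $t\to\infty$. (II) (A$_0$) $\iff$ $y(t)=o(\gamma(t))$ as $t\to\infty$ $\iff$ $x(t)=o(\gamma(t))$ as $t\to\infty$. (III) (A) and (A$_+$) hold $\iff$ $\limsup_{t\to\infty}|y(t)|/\gamma(t)\in(0,\infty)$ $\iff$ $\limsup_{t\to\infty}|x(t)|/\gamma(t)\in(0,\infty)$. Moreover, if $\gamma$ is bounded below by a positive constant on each interval $[0,T]$ (for instance in case (ii), or if $\gamma$ is continuous on $[0,\infty)$), then (A) holds if and only if it holds with $T=0$. -/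

import Mathlib

open Set Filter Topology MeasureTheory Asymptotics

/-- The exponent `κ = -log|b/a| / log(1/q)`, i.e. the real part of any complex solution `k` of
`a q^k + b = 0` (for `a ≠ 0`). -/
noncomputable def pantographExponent (a b q : ℝ) : ℝ :=
  -(Real.log |b / a|) / Real.log (1 / q)

/-- `x` solves the forced pantograph equation `x'(t) = a x(qt) + b x(t) + f(t)`, `t ≥ 0`,
`x(0) = ζ`. The derivative at `t = 0` is one-sided; continuity of `x` on `[0,∞)` follows. -/
def IsPantographSolution (a b q : ℝ) (f : ℝ → ℝ) (ζ : ℝ) (x : ℝ → ℝ) : Prop :=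
  x 0 = ζ ∧ ∀ t, 0 ≤ t → HasDerivWithinAt x (a * x (q * t) + b * x t + f t) (Ici 0) t

/-- `y` solves the auxiliary equation `y'(t) = -y(t) + f(t)`, `t ≥ 0`, `y(0) = 0`. -/
def IsAuxiliarySolution (f y : ℝ → ℝ) : Prop :=
  y 0 = 0 ∧ ∀ t, 0 ≤ t → HasDerivWithinAt y (-y t + f t) (Ici 0) t

/-- `γ : [0,∞) → (0,∞)` is (Lebesgue) measurable and regularly varying at infinity with
index `η`. -/
def IsRegularlyVarying (η : ℝ) (γ : ℝ → ℝ) : Prop :=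
  (∀ t, 0 ≤ t → 0 < γ t) ∧ AEMeasurable γ (volume.restrict (Ici 0)) ∧
    ∀ c : ℝ, 0 < c → Tendsto (fun t => γ (c * t) / γ t) atTop (𝓝 (c ^ η))

/-- `γ` is positive, increasing (in the wide sense) and `C^1` on `[0,∞)`, and tends to infinity. -/
def IsIncreasingUnboundedWeight (γ : ℝ → ℝ) : Prop :=
  (∀ t, 0 ≤ t → 0 < γ t) ∧ MonotoneOn γ (Ici 0) ∧ ContDiffOn ℝ 1 γ (Ici 0) ∧
    Tendsto γ atTop atTop

/-- `f_θ(t) = ∫_{(t-θ)^+}^t f(s) ds`. -/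
noncomputable def movingIntegral (f : ℝ → ℝ) (θ t : ℝ) : ℝ :=
  ∫ s in (max (t - θ) 0)..t, f s

/-- For some `K > 0`, `sup_{0 ≤ θ ≤ 1} |f_θ(t)| ≤ K γ(t)` for every `t ≥ T`. -/
def MovingIntegralBoundFrom (T : ℝ) (f γ : ℝ → ℝ) : Prop :=
  ∃ K : ℝ, 0 < K ∧ ∀ t, T ≤ t → ∀ θ ∈ Icc (0 : ℝ) 1, |movingIntegral f θ t| ≤ K * γ t

/-- `sup_{0 ≤ θ ≤ 1} |f_θ(t)| = O(γ(t))` as `t → ∞`. -/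
def MovingIntegralBigO (f γ : ℝ → ℝ) : Prop :=
  ∃ T : ℝ, 0 ≤ T ∧ MovingIntegralBoundFrom T f γ

/-- `f_θ(t) = o(γ(t))` as `t → ∞`, for each `θ ∈ [0,1]`. -/
def MovingIntegralLittleO (f γ : ℝ → ℝ) : Prop :=
  ∀ θ ∈ Icc (0 : ℝ) 1, movingIntegral f θ =o[atTop] γ

/-- `limsup_{t → ∞} |u(t)| / γ(t)`, as an extended real number. -/
noncomputable def limsupRatio (u γ : ℝ → ℝ) : EReal :=
  limsup (fun t => ((|u t| / γ t : ℝ) : EReal)) atTop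

/-! ### Uniform convergence for slowly varying functions -/

/-! Both classes of weights enter mainly through two properties. The first is `SlowDecay`: `γ` never
decays exponentially, which is monotonicity in case (ii) and Karamata's uniform convergence theorem
in case (i). The second is a contraction `|a| γ(qt) ≤ ρ |b| γ(t)` for large `t` with `ρ < 1`, which
comes from `|a| < |b|` in case (ii) and from `η > κ`, that is `|a| q^η < |b|`, in case (i).

Under these, a solution of `z' = a z(qt) + b z + g` inherits `O(γ)` or `o(γ)` from `g`: with the
delayed term treated as forcing, a bound for `|z|/γ` reproduces itself with a factor `r < 1`
(`isBigO_of_pantograph`, `isLittleO_of_pantograph`). In `x - y` the function `f` cancels, leaving a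
forcing made of `y` alone; in `y - x`, read as an undelayed equation, it is made of `x` alone. Hence
`x` and `y` have the same order.

Integrating `y' = -y + f` bounds `f_θ` by `y` over a unit interval; conversely `|y(t)| ≤ e⁻¹|y(t-1)|
+ 2 sup_θ |f_θ(t)|`, again a contraction. Smallness for each `θ` becomes uniform by Baire's theorem.
Part (III) is "`O` but not `o`". -/

theorem exists_two_lt_volume_setOf_forall_ge {k : ℝ → ℝ} (hk : AEMeasurable k volume)
    (h : ∀ c : ℝ, 0 < c → Tendsto (fun t => k (c * t) - k t) atTop (𝓝 0))
    {ε : ℝ} (hε : 0 < ε) {τ : ℕ → ℝ} (hτ : ∀ n, 0 < τ n) (hτ' : Tendsto τ atTop atTop) :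
    ∀ᶠ n in atTop,
      NullMeasurableSet {l : ℝ | l ∈ Icc (1 : ℝ) 4 ∧ ∀ m, n ≤ m → |k (l * τ m) - k (τ m)| < ε} ∧
        2 < volume {l : ℝ | l ∈ Icc (1 : ℝ) 4 ∧ ∀ m, n ≤ m → |k (l * τ m) - k (τ m)| < ε} := by
  set V : ℕ → Set ℝ :=
    fun n => {l : ℝ | l ∈ Icc (1 : ℝ) 4 ∧ ∀ m, n ≤ m → |k (l * τ m) - k (τ m)| < ε} with hV
  have hnull : ∀ n, NullMeasurableSet (V n) := by
    intro n
    have : V n = Icc (1 : ℝ) 4 ∩ ⋂ m, ⋂ (_ : n ≤ m), {l | |k (l * τ m) - k (τ m)| < ε} := by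
      ext l; simp [hV]
    rw [this]
    refine measurableSet_Icc.nullMeasurableSet.inter
      (NullMeasurableSet.iInter fun m => NullMeasurableSet.iInter fun _ => ?_)
    have hq : Measure.QuasiMeasurePreserving (fun l : ℝ => l * τ m) volume volume := by
      refine ⟨measurable_id.mul_const _, ?_⟩
      rw [Real.map_volume_mul_right (hτ m).ne']
      exact Measure.smul_absolutelyContinuous
    have hc : AEMeasurable (fun l => k (l * τ m)) volume := hk.comp_quasiMeasurePreserving hq
    have hc' : AEMeasurable (fun l => |k (l * τ m) - k (τ m)|) volume :=
      (hc.sub_const _).abs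
    exact nullMeasurableSet_lt hc' aemeasurable_const
  have hmono : Monotone V := fun n n' hn l hl => ⟨hl.1, fun m hm => hl.2 m (hn.trans hm)⟩
  have hunion : ⋃ n, V n = Icc (1 : ℝ) 4 := by
    ext l
    simp only [mem_iUnion]
    refine ⟨fun ⟨n, hn⟩ => hn.1, fun hl => ?_⟩
    have h1 := ((h l (by linarith [hl.1])).comp hτ').eventually (Metric.ball_mem_nhds 0 hε)
    obtain ⟨n, hn⟩ := eventually_atTop.1 h1
    refine ⟨n, hl, fun m hm => ?_⟩
    simpa [Real.dist_eq] using hn m hm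
  -- Continuity from below: the measures increase to that of `[1,4]`, which is `3 > 2`.
  have htend := tendsto_measure_iUnion_atTop (μ := volume) hmono
  rw [hunion, Real.volume_Icc] at htend
  have h2 : (2 : ENNReal) < ENNReal.ofReal (4 - 1) := by
    rw [show (2 : ENNReal) = ENNReal.ofReal 2 by simp]
    exact (ENNReal.ofReal_lt_ofReal_iff (by norm_num)).2 (by norm_num)
  filter_upwards [htend.eventually (lt_mem_nhds h2)] with n hn using ⟨hnull n, hn⟩

open scoped Pointwise in
/-- Karamata's uniform convergence theorem, on the compact set `[1, 5/4]`. -/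
theorem eventually_forall_abs_sub_lt_of_tendsto {k : ℝ → ℝ} (hk : AEMeasurable k volume)
    (h : ∀ c : ℝ, 0 < c → Tendsto (fun t => k (c * t) - k t) atTop (𝓝 0))
    {ε : ℝ} (hε : 0 < ε) :
    ∃ T : ℝ, ∀ s, T ≤ s → ∀ c ∈ Icc (1 : ℝ) (5 / 4), |k (c * s) - k s| < ε := by
  by_contra! hcon
  choose s hs c hc hsc using fun n : ℕ => hcon ((n : ℝ) + 1)
  have hs0 : ∀ n, 0 < s n := fun n => by
    have := hs n; have := n.cast_nonneg (α := ℝ); linarith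
  have hst : Tendsto s atTop atTop :=
    tendsto_atTop_mono (fun n => by linarith [hs n]) tendsto_natCast_atTop_atTop
  have hcs0 : ∀ n, 0 < c n * s n := fun n => mul_pos (by linarith [(hc n).1]) (hs0 n)
  have hcst : Tendsto (fun n => c n * s n) atTop atTop :=
    tendsto_atTop_mono (fun n => by nlinarith [(hc n).1, hs0 n]) hst
  -- `V` and `c n • W` both have measure above 2 and lie in `[1,5]`, of measure 4, so they must
  -- meet. A common point `l` would put `k (l * s n)` within `ε/2` of both `k (s n)` and `k (c n * s
  -- n)`, against `hsc`.
  obtain ⟨n, ⟨hVm, hV⟩, -, hW⟩ :=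
    ((exists_two_lt_volume_setOf_forall_ge hk h (half_pos hε) hs0 hst).and
      (exists_two_lt_volume_setOf_forall_ge hk h (half_pos hε) hcs0 hcst)).exists
  set V := {l : ℝ | l ∈ Icc (1 : ℝ) 4 ∧ ∀ m, n ≤ m → |k (l * s m) - k (s m)| < ε / 2}
  set W := {l : ℝ | l ∈ Icc (1 : ℝ) 4 ∧
    ∀ m, n ≤ m → |k (l * (c m * s m)) - k (c m * s m)| < ε / 2}
  have hW' : 2 < volume ((c n) • W) := by
    rw [Measure.addHaar_smul]
    refine hW.trans_le ?_
    simp only [Module.finrank_self, pow_one]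
    have : (1 : ENNReal) ≤ ENNReal.ofReal |c n| := by
      rw [ENNReal.one_le_ofReal]; exact (hc n).1.trans (le_abs_self _)
    calc volume W = 1 * volume W := (one_mul _).symm
      _ ≤ _ := by gcongr
  have hdisj : Disjoint V ((c n) • W) := by
    rw [Set.disjoint_left]
    rintro l hlV ⟨l', hlW, rfl⟩
    have h1 := hlV.2 n le_rfl
    have h2 := hlW.2 n le_rfl
    have h3 := hsc n
    simp only [smul_eq_mul] at h1
    rw [show c n * l' * s n = l' * (c n * s n) by ring] at h1
    rw [abs_lt] at h1 h2
    rcases le_abs.1 h3 with h3 | h3 <;> linarith [h1.1, h1.2, h2.1, h2.2]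
  have hsub : V ∪ (c n) • W ⊆ Icc (1 : ℝ) 5 := by
    rintro l (hl | ⟨l', hl', rfl⟩)
    · exact ⟨hl.1.1, by linarith [hl.1.2]⟩
    · have h1 := hl'.1.1
      have h2 := hl'.1.2
      have h3 := (hc n).1
      have h4 := (hc n).2
      simp only [smul_eq_mul, mem_Icc]
      constructor <;> nlinarith
  have hle := measure_mono (μ := volume) hsub
  rw [measure_union₀' hVm hdisj.aedisjoint, Real.volume_Icc] at hle
  have h4 : (4 : ENNReal) < volume V + volume ((c n) • W) := by
    calc (4 : ENNReal) = 2 + 2 := by norm_num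
      _ < _ := ENNReal.add_lt_add hV hW'
  have h5 : ENNReal.ofReal (5 - 1) = 4 := by norm_num
  rw [h5] at hle
  exact absurd h4 hle.not_gt

/-! ### Weights that decay subexponentially -/

/-- `γ` cannot decay exponentially fast: past a threshold, `γ s ≤ e^{ε (t - s) + ε} γ t`
whenever `s ≤ t`. -/
def SlowDecay (γ : ℝ → ℝ) : Prop :=
  ∀ ε : ℝ, 0 < ε → ∃ T : ℝ, 0 ≤ T ∧
    ∀ s t, T ≤ s → s ≤ t → γ s ≤ Real.exp (ε * (t - s) + ε) * γ t

/-- Each of the `⌊t - s⌋` unit steps costs `e^ε`; the remaining fractional step accounts for the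
additive `ε` in the exponent. -/
theorem slowDecay_of_forall_le_add_one {γ : ℝ → ℝ}
    (h : ∀ ε : ℝ, 0 < ε → ∃ T : ℝ, 0 ≤ T ∧
      ∀ s t, T ≤ s → s ≤ t → t ≤ s + 1 → γ s ≤ Real.exp ε * γ t) : SlowDecay γ := by
  intro ε hε
  obtain ⟨T, hT, hle⟩ := h ε hε
  have hn : ∀ n : ℕ, ∀ s, T ≤ s → γ s ≤ Real.exp (ε * n) * γ (s + n) := by
    intro n
    induction n with
    | zero => intro s _; simp
    | succ n ih =>
      intro s hs
      refine (ih s hs).trans ?_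
      have h1 := hle (s + n) (s + n + 1) (by linarith [n.cast_nonneg (α := ℝ)]) (by linarith)
        le_rfl
      calc Real.exp (ε * n) * γ (s + n)
          ≤ Real.exp (ε * n) * (Real.exp ε * γ (s + n + 1)) := by gcongr
        _ = Real.exp (ε * (n + 1 : ℕ)) * γ (s + (n + 1 : ℕ)) := by
            push_cast; rw [← mul_assoc, ← Real.exp_add, add_assoc]; ring_nf
  refine ⟨T, hT, fun s t hs hst => ?_⟩
  have hpos : 0 ≤ t - s := by linarith
  set n := ⌊t - s⌋₊
  have hn1 : (n : ℝ) ≤ t - s := Nat.floor_le hpos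
  have hn2 : t - s < n + 1 := Nat.lt_floor_add_one _
  -- Positivity is not assumed; taking both points equal gives `γ t ≤ e^ε γ t` with `e^ε > 1`.
  have hγ : 0 ≤ γ t := by
    have h1 := hle t t (hs.trans hst) le_rfl (by linarith)
    have h2 : 1 < Real.exp ε := Real.one_lt_exp_iff.2 hε
    nlinarith
  calc γ s ≤ Real.exp (ε * n) * γ (s + n) := hn n s hs
    _ ≤ Real.exp (ε * n) * (Real.exp ε * γ t) := by
        gcongr
        exact hle _ _ (by linarith [n.cast_nonneg (α := ℝ)]) (by linarith) (by linarith)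
    _ = Real.exp (ε * n + ε) * γ t := by rw [← mul_assoc, ← Real.exp_add]
    _ ≤ _ := by gcongr

theorem IsIncreasingUnboundedWeight.slowDecay {γ : ℝ → ℝ} (h : IsIncreasingUnboundedWeight γ) :
    SlowDecay γ := by
  intro ε hε
  refine ⟨0, le_rfl, fun s t hs hst => ?_⟩
  have h1 : γ s ≤ γ t := h.2.1 hs (hs.trans hst) hst
  have h2 : 1 ≤ Real.exp (ε * (t - s) + ε) :=
    Real.one_le_exp (by have := mul_nonneg hε.le (sub_nonneg.2 hst); linarith)
  nlinarith [h.1 t (hs.trans hst)]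

/-- Over a unit step the ratio `t / s` tends to 1, so uniform convergence controls the slowly
varying part `log γ - η log`, while `η log (t/s)` is at most `|η|/s` in size. -/
theorem IsRegularlyVarying.slowDecay {η : ℝ} {γ : ℝ → ℝ} (h : IsRegularlyVarying η γ) :
    SlowDecay γ := by
  obtain ⟨hpos, hmeas, hlim⟩ := h
  set k : ℝ → ℝ := (Ici (0 : ℝ)).indicator (fun t => Real.log (γ t) - η * Real.log t) with hk
  have hkval : ∀ t, 0 ≤ t → k t = Real.log (γ t) - η * Real.log t := fun t ht =>
    indicator_of_mem (s := Ici (0 : ℝ)) ht _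
  have hkm : AEMeasurable k volume := by
    rw [hk, aemeasurable_indicator_iff measurableSet_Ici]
    exact (Real.measurable_log.comp_aemeasurable hmeas).sub
      (Real.measurable_log.const_mul η).aemeasurable
  have hkt : ∀ c : ℝ, 0 < c → Tendsto (fun t => k (c * t) - k t) atTop (𝓝 0) := by
    intro c hc
    have h1 := (Real.continuousAt_log (Real.rpow_pos_of_pos hc η).ne').tendsto.comp (hlim c hc)
    have h2 := h1.sub_const (η * Real.log c)
    rw [Real.log_rpow hc, sub_self] at h2
    refine h2.congr' ?_
    filter_upwards [eventually_gt_atTop 0] with t ht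
    have hct : 0 < c * t := mul_pos hc ht
    simp only [Function.comp_apply]
    rw [hkval _ hct.le, hkval _ ht.le, Real.log_div (hpos _ hct.le).ne' (hpos _ ht.le).ne',
      Real.log_mul hc.ne' ht.ne']
    ring
  refine slowDecay_of_forall_le_add_one fun ε hε => ?_
  obtain ⟨T, hT⟩ := eventually_forall_abs_sub_lt_of_tendsto hkm hkt (half_pos hε)
  -- `s ≥ 4` puts `t / s` in `[1, 5/4]`; `s ≥ 2|η|/ε` gives `|η|/s ≤ ε/2`.
  refine ⟨max T (max 4 (2 * |η| / ε)), by positivity, fun s t hs hst hts => ?_⟩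
  have hs1 : T ≤ s := (le_max_left _ _).trans hs
  have hs2 : 4 ≤ s := ((le_max_left _ _).trans (le_max_right _ _)).trans hs
  have hs3 : 2 * |η| / ε ≤ s := ((le_max_right _ _).trans (le_max_right _ _)).trans hs
  have hs0 : 0 < s := by linarith
  have ht0 : 0 < t := by linarith
  have hc : t / s ∈ Icc (1 : ℝ) (5 / 4) :=
    ⟨by rw [le_div_iff₀ hs0]; linarith, by rw [div_le_iff₀ hs0]; linarith⟩
  have h1 := hT s hs1 _ hc
  rw [div_mul_cancel₀ _ hs0.ne', hkval t ht0.le, hkval s hs0.le] at h1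
  have h2 : 0 ≤ Real.log (t / s) := Real.log_nonneg hc.1
  have h3 : Real.log (t / s) ≤ 1 / s := by
    refine (Real.log_le_sub_one_of_pos (by positivity)).trans ?_
    rw [div_sub_one hs0.ne']
    gcongr; linarith
  rw [Real.log_div ht0.ne' hs0.ne'] at h2 h3
  have h4 : |η| * (1 / s) ≤ ε / 2 := by
    rw [div_le_iff₀ hε] at hs3
    rw [mul_one_div, div_le_iff₀ hs0]; linarith
  have h5 : |η * (Real.log t - Real.log s)| ≤ ε / 2 := by
    rw [abs_mul, abs_of_nonneg h2]
    exact (mul_le_mul_of_nonneg_left h3 (abs_nonneg _)).trans h4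
  have h6 : Real.log (γ s) ≤ ε + Real.log (γ t) := by
    have := abs_lt.1 h1; have := abs_le.1 h5; linarith
  calc γ s = Real.exp (Real.log (γ s)) := (Real.exp_log (hpos s hs0.le)).symm
    _ ≤ Real.exp (ε + Real.log (γ t)) := Real.exp_le_exp.2 h6
    _ = Real.exp ε * γ t := by rw [Real.exp_add, Real.exp_log (hpos t ht0.le)]

/-! ### Contraction of the delayed term -/

theorem IsIncreasingUnboundedWeight.exists_delay_contraction {a b q : ℝ} {γ : ℝ → ℝ}
    (hq : q ∈ Ioo (0 : ℝ) 1) (hb : b < 0) (hab : |a| < |b|) (h : IsIncreasingUnboundedWeight γ) :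
    ∃ ρ : ℝ, 0 ≤ ρ ∧ ρ < 1 ∧ ∀ᶠ t in atTop, |a| * γ (q * t) ≤ ρ * -b * γ t := by
  have hb' : |b| = -b := abs_of_neg hb
  have hbpos : 0 < -b := by linarith
  rw [hb'] at hab
  refine ⟨|a| / -b, by positivity, (div_lt_one hbpos).2 hab, ?_⟩
  filter_upwards [eventually_ge_atTop 0] with t ht
  rw [div_mul_cancel₀ _ hbpos.ne']
  have hqt : 0 ≤ q * t := mul_nonneg hq.1.le ht
  exact mul_le_mul_of_nonneg_left (h.2.1 hqt ht (by nlinarith [hq.2])) (abs_nonneg a)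

/-- `κ` is the exponent with `|a| q^κ = |b|`, and `q^η` decreases in `η` because `q < 1`. -/
theorem abs_mul_rpow_lt_of_pantographExponent_lt {a b q η : ℝ}
    (hq : q ∈ Ioo (0 : ℝ) 1) (ha : a ≠ 0) (hb : b < 0) (hη : pantographExponent a b q < η) :
    |a| * q ^ η < -b := by
  have hlq : Real.log q < 0 := Real.log_neg hq.1 hq.2
  have ha' : 0 < |a| := abs_pos.2 ha
  have h1 : Real.log q * η < Real.log (-b / |a|) := by
    rw [pantographExponent, one_div, Real.log_inv, neg_div_neg_eq, div_lt_iff_of_neg hlq] at hη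
    rw [abs_div, abs_of_neg hb] at hη
    linarith
  rw [Real.rpow_def_of_pos hq.1, mul_comm, ← lt_div_iff₀ ha',
    ← Real.exp_log (show 0 < -b / |a| from div_pos (by linarith) ha')]
  exact Real.exp_lt_exp.2 h1

theorem IsRegularlyVarying.exists_delay_contraction {a b q η : ℝ} {γ : ℝ → ℝ}
    (hq : q ∈ Ioo (0 : ℝ) 1) (ha : a ≠ 0) (hb : b < 0) (hη : pantographExponent a b q < η)
    (h : IsRegularlyVarying η γ) :
    ∃ ρ : ℝ, 0 ≤ ρ ∧ ρ < 1 ∧ ∀ᶠ t in atTop, |a| * γ (q * t) ≤ ρ * -b * γ t := by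
  have hbpos : 0 < -b := by linarith
  have hlt := abs_mul_rpow_lt_of_pantographExponent_lt hq ha hb hη
  obtain ⟨d, hd1, hd2⟩ := exists_between hlt
  have hd0 : 0 ≤ d := le_trans (mul_nonneg (abs_nonneg a) (Real.rpow_nonneg hq.1.le η)) hd1.le
  refine ⟨d / -b, by positivity, (div_lt_one hbpos).2 hd2, ?_⟩
  filter_upwards [((h.2.2 q hq.1).const_mul |a|).eventually (gt_mem_nhds hd1),
    eventually_gt_atTop 0] with t ht ht0
  rw [div_mul_cancel₀ _ hbpos.ne']
  have hγ := h.1 t ht0.le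
  rw [← mul_div_assoc, div_lt_iff₀ hγ] at ht
  exact ht.le

/-! ### Order symbols with explicit thresholds -/

theorem isBigO_atTop_iff_exists_forall_ge {u γ : ℝ → ℝ} (hγ : ∀ t, 0 ≤ t → 0 < γ t) :
    u =O[atTop] γ ↔ ∃ K : ℝ, 0 < K ∧ ∃ T : ℝ, 0 ≤ T ∧ ∀ t, T ≤ t → |u t| ≤ K * γ t := by
  constructor
  · intro h
    obtain ⟨K, hK, hu⟩ := h.exists_pos
    obtain ⟨T, hT⟩ := eventually_atTop.1 hu.bound
    refine ⟨K, hK, max T 0, le_max_right _ _, fun t ht => ?_⟩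
    have := hT t ((le_max_left _ _).trans ht)
    rwa [Real.norm_eq_abs, Real.norm_eq_abs,
      abs_of_pos (hγ t ((le_max_right _ _).trans ht))] at this
  · rintro ⟨K, -, T, hT, hu⟩
    refine IsBigO.of_bound K ?_
    filter_upwards [eventually_ge_atTop T] with t ht
    rw [Real.norm_eq_abs, Real.norm_eq_abs, abs_of_pos (hγ t (hT.trans ht))]
    exact hu t ht

theorem isLittleO_atTop_iff_forall_exists_forall_ge {u γ : ℝ → ℝ}
    (hγ : ∀ t, 0 ≤ t → 0 < γ t) :
    u =o[atTop] γ ↔ ∀ δ : ℝ, 0 < δ → ∃ T : ℝ, 0 ≤ T ∧ ∀ t, T ≤ t → |u t| ≤ δ * γ t := by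
  rw [isLittleO_iff]
  refine forall₂_congr fun δ _ => ⟨fun h => ?_, fun ⟨T, hT, h⟩ => ?_⟩
  · obtain ⟨T, hT⟩ := eventually_atTop.1 h
    refine ⟨max T 0, le_max_right _ _, fun t ht => ?_⟩
    have := hT t ((le_max_left _ _).trans ht)
    rwa [Real.norm_eq_abs, Real.norm_eq_abs,
      abs_of_pos (hγ t ((le_max_right _ _).trans ht))] at this
  · filter_upwards [eventually_ge_atTop T] with t ht
    rw [Real.norm_eq_abs, Real.norm_eq_abs, abs_of_pos (hγ t (hT.trans ht))]
    exact h t ht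

/-- A function bounded by `A + r` times its running supremum is bounded by `A / (1 - r)`. -/
theorem le_div_of_forall_le_add_mul_of_bddAbove {φ : ℝ → ℝ} {T A r : ℝ} (hr : r < 1)
    (hbdd : ∀ t, T ≤ t → BddAbove (φ '' Icc T t))
    (h : ∀ t, T ≤ t → ∀ S, (∀ s ∈ Icc T t, φ s ≤ S) → φ t ≤ A + r * S) :
    ∀ t, T ≤ t → φ t ≤ A / (1 - r) := by
  intro t ht
  set S := sSup (φ '' Icc T t)
  have hS : ∀ s ∈ Icc T t, φ s ≤ S := fun s hs => le_csSup (hbdd t ht) ⟨s, hs, rfl⟩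
  have hle : S ≤ A + r * S := by
    refine csSup_le ⟨_, t, right_mem_Icc.2 ht, rfl⟩ ?_
    rintro _ ⟨s, hs, rfl⟩
    exact h s hs.1 S fun s' hs' => hS s' ⟨hs'.1, hs'.2.trans hs.2⟩
  refine (hS t (right_mem_Icc.2 ht)).trans ?_
  rw [le_div_iff₀ (by linarith)]
  linarith

/-- If eventual upper bounds for `|u| / γ` improve by the factor `r < 1`, then `u = o(γ)`. -/
theorem isLittleO_of_forall_eventually_le {u γ : ℝ → ℝ} {r : ℝ}
    (hγ : ∀ t, 0 ≤ t → 0 < γ t) (hr0 : 0 ≤ r) (hr : r < 1) (hO : u =O[atTop] γ)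
    (h : ∀ C δ : ℝ, 0 ≤ C → 0 < δ → (∀ᶠ t in atTop, |u t| ≤ C * γ t) →
      ∀ᶠ t in atTop, |u t| ≤ (r * C + δ) * γ t) : u =o[atTop] γ := by
  obtain ⟨K, hK, T, -, hu⟩ := (isBigO_atTop_iff_exists_forall_ge hγ).1 hO
  -- Iterating `C ↦ r C + δ` from `K` stays below `r^n K` plus the fixed point `δ/(1-r)`.
  have hpow : ∀ δ : ℝ, 0 < δ → ∀ n : ℕ,
      ∀ᶠ t in atTop, |u t| ≤ (r ^ n * K + δ / (1 - r)) * γ t := by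
    intro δ hδ n
    have hd : 0 < δ / (1 - r) := div_pos hδ (by linarith)
    induction n with
    | zero =>
      filter_upwards [eventually_ge_atTop T, eventually_ge_atTop 0] with t ht ht0
      have := hγ t ht0
      have h2 := hu t ht
      simp only [pow_zero, one_mul]
      nlinarith
    | succ n ih =>
      have h1 := h _ δ (by positivity) hδ ih
      refine h1.mono fun t ht => ht.trans_eq ?_
      have : 1 - r ≠ 0 := by linarith
      field_simp
      ring
  rw [isLittleO_iff]
  intro δ hδ
  obtain ⟨n, hn⟩ := exists_pow_lt_of_lt_one (show 0 < δ / 2 / K by positivity) hr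
  have h1 : 0 < 1 - r := by linarith
  filter_upwards [hpow (δ / 2 * (1 - r)) (by positivity) n, eventually_ge_atTop 0] with t ht ht0
  rw [Real.norm_eq_abs, Real.norm_eq_abs, abs_of_pos (hγ t ht0)]
  refine ht.trans (mul_le_mul_of_nonneg_right ?_ (hγ t ht0).le)
  rw [mul_div_cancel_right₀ _ h1.ne']
  rw [lt_div_iff₀ hK] at hn
  linarith

/-! ### Linear equations with a damping term -/

/-- Variation of constants, through the mean value inequality for `e^{-bs} z(s)`. The forcing may be
larger at earlier times, at rate `ε`, since that is all `SlowDecay` gives for `γ s` against `γ t`.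
-/
theorem abs_le_of_hasDerivWithinAt_damped {z h : ℝ → ℝ} {b ε D T t : ℝ} (hbε : b + ε < 0)
    (hTt : T ≤ t) (hzc : ContinuousOn z (Icc T t))
    (hz : ∀ s ∈ Ico T t, HasDerivWithinAt z (b * z s + h s) (Ici s) s)
    (hh : ∀ s ∈ Ico T t, |h s| ≤ D * Real.exp (ε * (t - s))) (hD : 0 ≤ D) :
    |z t| ≤ Real.exp (b * (t - T)) * |z T| + D / (-b - ε) := by
  set B : ℝ → ℝ := fun s => Real.exp (-b * T) * |z T| + D * Real.exp (ε * t) / (-b - ε) *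
    (Real.exp ((-b - ε) * s) - Real.exp ((-b - ε) * T)) with hB
  have hne : -b - ε ≠ 0 := by linarith
  have hexp : ∀ c s : ℝ, HasDerivAt (fun s => Real.exp (c * s)) (Real.exp (c * s) * c) s :=
    fun c s => by simpa using ((hasDerivAt_id s).const_mul c).exp
  have hmain := image_norm_le_of_norm_deriv_right_le_deriv_boundary
    (f := fun s => Real.exp (-b * s) * z s) (f' := fun s => Real.exp (-b * s) * h s)
    (a := T) (b := t) (B := B)
    (B' := fun s => D * Real.exp (ε * t) / (-b - ε) * (Real.exp ((-b - ε) * s) * (-b - ε)))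
    ((by fun_prop : Continuous fun s => Real.exp (-b * s)).continuousOn.mul hzc)
    (fun s hs => by
      refine ((hexp (-b) s).hasDerivWithinAt.mul (hz s hs)).congr_deriv ?_
      ring)
    (by simp [hB])
    (fun s => by
      exact (((hexp (-b - ε) s).sub_const _).const_mul _).const_add _)
    (fun s hs => by
      rw [norm_mul, Real.norm_eq_abs, Real.norm_eq_abs, Real.abs_exp]
      calc Real.exp (-b * s) * |h s| ≤ Real.exp (-b * s) * (D * Real.exp (ε * (t - s))) := by
            gcongr; exact hh s hs
        _ = D * (Real.exp (-b * s) * Real.exp (ε * (t - s))) := by ring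
        _ = D * (Real.exp (ε * t) * Real.exp ((-b - ε) * s)) := by
            rw [← Real.exp_add, ← Real.exp_add]; ring_nf
        _ = _ := by field_simp)
    (right_mem_Icc.2 hTt)
  rw [norm_mul, Real.norm_eq_abs, Real.norm_eq_abs, Real.abs_exp] at hmain
  have h1 : |z t| = Real.exp (b * t) * (Real.exp (-b * t) * |z t|) := by
    rw [← mul_assoc, ← Real.exp_add]; simp
  rw [h1]
  have hpos : 0 < -b - ε := by linarith
  calc Real.exp (b * t) * (Real.exp (-b * t) * |z t|) ≤ Real.exp (b * t) * B t := by gcongr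
    _ ≤ Real.exp (b * t) * (Real.exp (-b * T) * |z T| + D * Real.exp (ε * t) / (-b - ε) *
          Real.exp ((-b - ε) * t)) := by
        simp only [hB]
        gcongr
        linarith [Real.exp_pos ((-b - ε) * T)]
    _ = Real.exp (b * t) * Real.exp (-b * T) * |z T| + D / (-b - ε) *
          (Real.exp (b * t) * Real.exp (ε * t) * Real.exp ((-b - ε) * t)) := by ring
    _ = _ := by
        rw [← Real.exp_add, ← Real.exp_add, ← Real.exp_add]
        ring_nf
        simp

/-! ### Perturbed pantograph equations in weighted spaces -/

theorem abs_le_of_pantograph_of_forall_le {a b q ε T₀ T S ρ K t : ℝ} {z g γ : ℝ → ℝ}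
    (hq : q ∈ Ioo (0 : ℝ) 1) (hε : 0 < ε) (hbε : b + ε < 0) (hρ : 0 ≤ ρ) (hT : 0 ≤ T)
    (hT₀ : T₀ ≤ q * T) (hγ : ∀ t, 0 ≤ t → 0 < γ t)
    (hslow : ∀ s t, T₀ ≤ s → s ≤ t → γ s ≤ Real.exp (ε * (t - s) + ε) * γ t)
    (hcontr : ∀ s, T ≤ s → |a| * γ (q * s) ≤ ρ * -b * γ s)
    (hzc : ContinuousOn z (Ici 0))
    (hz : ∀ t, 0 ≤ t → HasDerivWithinAt z (a * z (q * t) + b * z t + g t) (Ici t) t)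
    (hTt : T ≤ t) (hS0 : 0 ≤ S) (hS : ∀ s ∈ Icc (q * T) t, |z s| ≤ S * γ s)
    (hK : 0 ≤ K) (hg : ∀ s, T ≤ s → |g s| ≤ K * γ s) :
    |z t| ≤ Real.exp (b * (t - T)) * |z T| +
      (S * (ρ * -b) + K) * (Real.exp ε * γ t) / (-b - ε) := by
  have hb : 0 < -b := by linarith
  have hqT : q * T ≤ T := by nlinarith [hq.2]
  have hγt := hγ t (hT.trans hTt)
  refine abs_le_of_hasDerivWithinAt_damped (h := fun s => a * z (q * s) + g s) hbε hTt
    (hzc.mono fun s hs => hT.trans hs.1)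
    (fun s hs => (hz s (hT.trans hs.1)).congr_deriv (by ring)) (fun s hs => ?_) (by positivity)
  have hs0 : 0 ≤ s := hT.trans hs.1
  have hqs : |z (q * s)| ≤ S * γ (q * s) :=
    hS _ ⟨mul_le_mul_of_nonneg_left hs.1 hq.1.le, by nlinarith [hq.2, hs.2]⟩
  have h1 := hcontr s hs.1
  have h2 := hslow s t (hT₀.trans (hqT.trans hs.1)) hs.2.le
  calc |a * z (q * s) + g s| ≤ |a| * |z (q * s)| + |g s| := by
        rw [← abs_mul]; exact abs_add_le _ _
    _ ≤ |a| * (S * γ (q * s)) + K * γ s := by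
        gcongr; exact hg s hs.1
    _ = S * (|a| * γ (q * s)) + K * γ s := by ring
    _ ≤ S * (ρ * -b * γ s) + K * γ s := by gcongr
    _ = (S * (ρ * -b) + K) * γ s := by ring
    _ ≤ (S * (ρ * -b) + K) * (Real.exp (ε * (t - s) + ε) * γ t) := by gcongr
    _ = _ := by rw [Real.exp_add]; ring

/-- At `ε = 0` the factor equals `ρ`, so continuity keeps it below 1 for small `ε`. -/
theorem exists_pos_exp_mul_div_lt_one {b ρ : ℝ} (hb : b < 0) (hρ : ρ < 1) :
    ∃ ε : ℝ, 0 < ε ∧ b + ε < 0 ∧ ρ * -b * Real.exp ε / (-b - ε) < 1 := by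
  have hcont : ContinuousAt (fun ε : ℝ => ρ * -b * Real.exp ε / (-b - ε)) 0 := by
    refine ContinuousAt.div (by fun_prop) (by fun_prop) ?_
    linarith
  have h0 : ρ * -b * Real.exp 0 / (-b - 0) < 1 := by
    have : -b ≠ 0 := by linarith
    rw [Real.exp_zero, mul_one, sub_zero, mul_div_cancel_right₀ _ this]; exact hρ
  have h1 : ∀ᶠ ε in 𝓝[>] (0 : ℝ), ρ * -b * Real.exp ε / (-b - ε) < 1 :=
    (hcont.eventually (gt_mem_nhds h0)).filter_mono nhdsWithin_le_nhds
  have h2 : ∀ᶠ ε in 𝓝[>] (0 : ℝ), ε < -b :=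
    (gt_mem_nhds (show (0 : ℝ) < -b by linarith)).filter_mono nhdsWithin_le_nhds
  obtain ⟨ε, ⟨h3, h4⟩, h5⟩ := ((h1.and h2).and self_mem_nhdsWithin).exists
  exact ⟨ε, h5, by linarith, h3⟩

/-- `γ` need not be continuous, so compactness alone does not bound it away from zero; slow decay
from `T` does. -/
theorem bddAbove_image_abs_div_of_slowDecay {ε T : ℝ} {z γ : ℝ → ℝ} (hε : 0 < ε) (hT : 0 ≤ T)
    (hγ : ∀ t, 0 ≤ t → 0 < γ t)
    (hslow : ∀ s t, T ≤ s → s ≤ t → γ s ≤ Real.exp (ε * (t - s) + ε) * γ t)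
    (hzc : ContinuousOn z (Ici 0)) (t : ℝ) :
    BddAbove ((fun s => |z s| / γ s) '' Icc T t) := by
  obtain ⟨M, hM⟩ := (isCompact_Icc (a := T) (b := t)).exists_bound_of_continuousOn
    (hzc.mono fun s hs => hT.trans hs.1)
  refine ⟨M * (Real.exp (ε * (t - T) + ε) / γ T), ?_⟩
  rintro _ ⟨s, hs, rfl⟩
  have hγT := hγ T hT
  have hγs := hγ s (hT.trans hs.1)
  have h1 : 1 / γ s ≤ Real.exp (ε * (t - T) + ε) / γ T := by
    rw [div_le_div_iff₀ hγs hγT, one_mul]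
    refine (hslow T s le_rfl hs.1).trans ?_
    gcongr
    exact hs.2
  have h2 : |z s| ≤ M := hM s hs
  calc |z s| / γ s = |z s| * (1 / γ s) := by ring
    _ ≤ _ := mul_le_mul h2 h1 (by positivity) ((abs_nonneg _).trans h2)

theorem isBigO_of_pantograph {a b q ρ : ℝ} {z g γ : ℝ → ℝ}
    (hq : q ∈ Ioo (0 : ℝ) 1) (hb : b < 0) (hρ0 : 0 ≤ ρ) (hρ : ρ < 1)
    (hγ : ∀ t, 0 ≤ t → 0 < γ t) (hslow : SlowDecay γ)
    (hcontr : ∀ᶠ t in atTop, |a| * γ (q * t) ≤ ρ * -b * γ t)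
    (hzc : ContinuousOn z (Ici 0))
    (hz : ∀ t, 0 ≤ t → HasDerivWithinAt z (a * z (q * t) + b * z t + g t) (Ici t) t)
    (hg : g =O[atTop] γ) : z =O[atTop] γ := by
  obtain ⟨ε, hε, hbε, hr⟩ := exists_pos_exp_mul_div_lt_one hb hρ
  obtain ⟨T₀, hT₀, hsl⟩ := hslow ε hε
  obtain ⟨K, hK, T₁, hT₁, hgK⟩ := (isBigO_atTop_iff_exists_forall_ge hγ).1 hg
  obtain ⟨T₂, hT₂⟩ := eventually_atTop.1 hcontr
  have hd : 0 < -b - ε := by linarith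
  -- Division by `q` makes slow decay available already on the initial interval `[qT, T]`, where
  -- delayed arguments start.
  set T := max (T₀ / q) (max T₁ T₂)
  have hTT₁ : T₁ ≤ T := (le_max_left _ _).trans (le_max_right _ _)
  have hTT₂ : T₂ ≤ T := (le_max_right _ _).trans (le_max_right _ _)
  have hT : 0 ≤ T := hT₁.trans hTT₁
  have hTT₀ : T₀ ≤ q * T := by
    rw [mul_comm, ← div_le_iff₀ hq.1]; exact le_max_left _ _
  have hqT : q * T ≤ T := by nlinarith [hq.2]
  have hqT0 : 0 ≤ q * T := hT₀.trans hTT₀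
  have hbdd := bddAbove_image_abs_div_of_slowDecay hε hqT0 hγ
    (fun s t hs => hsl s t (hTT₀.trans hs)) hzc
  obtain ⟨M, hM⟩ := hbdd T
  have hM' : ∀ s ∈ Icc (q * T) T, |z s| / γ s ≤ M := fun s hs => hM ⟨s, hs, rfl⟩
  have hM0 : 0 ≤ M := (div_nonneg (abs_nonneg _) (hγ T hT).le).trans (hM' T ⟨hqT, le_rfl⟩)
  set r := ρ * -b * Real.exp ε / (-b - ε)
  have hr0 : 0 ≤ r := by
    have : 0 < -b := by linarith
    positivity
  -- The three terms bound the initial interval, the homogeneous part and the forcing.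
  set A := M + Real.exp ε * (|z T| / γ T) + K * Real.exp ε / (-b - ε)
  have hγT := hγ T hT
  have hA : M ≤ A := by
    have h1 : 0 ≤ Real.exp ε * (|z T| / γ T) := by positivity
    have h2 : 0 ≤ K * Real.exp ε / (-b - ε) := by positivity
    simp only [A]; linarith
  have hfin := le_div_of_forall_le_add_mul_of_bddAbove (φ := fun s => |z s| / γ s) (T := q * T)
    (A := A) hr (fun t _ => hbdd t) (fun t ht S hS => by
      have hS0 : 0 ≤ S := (div_nonneg (abs_nonneg _) (hγ _ hqT0).le).trans
        (hS _ (left_mem_Icc.2 ht))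
      rcases le_total t T with htT | htT
      · have h1 := hM' t ⟨ht, htT⟩
        have h2 := mul_nonneg hr0 hS0
        linarith
      · have hγt := hγ t (hT.trans htT)
        have h1 := abs_le_of_pantograph_of_forall_le hq hε hbε hρ0 hT hTT₀ hγ hsl
          (fun s hs => hT₂ s (hTT₂.trans hs)) hzc hz htT hS0
          (fun s hs => (div_le_iff₀ (hγ s (hqT0.trans hs.1))).1 (hS s hs)) hK.le
          (fun s hs => hgK s (hTT₁.trans hs))
        have h2 : Real.exp (b * (t - T)) * γ T ≤ Real.exp ε * γ t := by
          calc Real.exp (b * (t - T)) * γ T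
              ≤ Real.exp (b * (t - T)) * (Real.exp (ε * (t - T) + ε) * γ t) := by
                gcongr; exact hsl T t (hTT₀.trans hqT) htT
            _ = Real.exp ((b + ε) * (t - T)) * (Real.exp ε * γ t) := by
                rw [← mul_assoc, ← mul_assoc, ← Real.exp_add, ← Real.exp_add]; ring_nf
            _ ≤ 1 * (Real.exp ε * γ t) := by
                gcongr
                rw [Real.exp_le_one_iff]
                exact mul_nonpos_of_nonpos_of_nonneg hbε.le (by linarith)
            _ = _ := one_mul _
        have h3 : Real.exp (b * (t - T)) * |z T| ≤ Real.exp ε * (|z T| / γ T) * γ t := by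
          calc Real.exp (b * (t - T)) * |z T|
              = Real.exp (b * (t - T)) * γ T * (|z T| / γ T) := by field_simp
            _ ≤ Real.exp ε * γ t * (|z T| / γ T) := by gcongr
            _ = _ := by ring
        rw [div_le_iff₀ hγt]
        have h4 : (S * (ρ * -b) + K) * (Real.exp ε * γ t) / (-b - ε) =
            (K * Real.exp ε / (-b - ε) + r * S) * γ t := by
          simp only [r]; ring
        have h5 : 0 ≤ M * γ t := by positivity
        calc |z t| ≤ _ := h1
          _ ≤ Real.exp ε * (|z T| / γ T) * γ t + (K * Real.exp ε / (-b - ε) + r * S) * γ t := by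
              rw [h4]; gcongr
          _ ≤ (A + r * S) * γ t := by simp only [A]; linarith)
  refine IsBigO.of_bound (A / (1 - r)) ?_
  filter_upwards [eventually_ge_atTop (q * T)] with t ht
  have hγt := hγ t (hqT0.trans ht)
  rw [Real.norm_eq_abs, Real.norm_eq_abs, abs_of_pos hγt]
  exact (div_le_iff₀ hγt).1 (hfin t ht)

/-- Slow decay at rate `-b/2` bounds `γ` below by a multiple of `e^{bt/2}`. -/
theorem SlowDecay.exp_mul_isLittleO {b : ℝ} {γ : ℝ → ℝ} (hb : b < 0)
    (hγ : ∀ t, 0 ≤ t → 0 < γ t) (hslow : SlowDecay γ) :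
    (fun t => Real.exp (b * t)) =o[atTop] γ := by
  set ε := -b / 2
  have hε : 0 < ε := by simp only [ε]; linarith
  obtain ⟨T, hT, hsl⟩ := hslow ε hε
  have hγT := hγ T hT
  have h1 : (fun t => Real.exp (-ε * t)) =O[atTop] γ := by
    refine IsBigO.of_bound (Real.exp (ε - ε * T) / γ T) ?_
    filter_upwards [eventually_ge_atTop T] with t ht
    rw [Real.norm_eq_abs, Real.norm_eq_abs, Real.abs_exp, abs_of_pos (hγ t (hT.trans ht)),
      div_mul_eq_mul_div, le_div_iff₀ hγT]
    calc Real.exp (-ε * t) * γ T ≤ Real.exp (-ε * t) * (Real.exp (ε * (t - T) + ε) * γ t) := by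
          gcongr; exact hsl T t le_rfl ht
      _ = _ := by rw [← mul_assoc, ← Real.exp_add]; ring_nf
  refine IsLittleO.trans_isBigO ?_ h1
  rw [Real.isLittleO_exp_comp_exp_comp]
  have : (fun t => -ε * t - b * t) = fun t => ε * t := by
    ext t; simp only [ε]; ring
  rw [this]
  exact tendsto_id.const_mul_atTop hε

theorem isLittleO_of_pantograph {a b q ρ : ℝ} {z g γ : ℝ → ℝ}
    (hq : q ∈ Ioo (0 : ℝ) 1) (hb : b < 0) (hρ0 : 0 ≤ ρ) (hρ : ρ < 1)
    (hγ : ∀ t, 0 ≤ t → 0 < γ t) (hslow : SlowDecay γ)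
    (hcontr : ∀ᶠ t in atTop, |a| * γ (q * t) ≤ ρ * -b * γ t)
    (hzc : ContinuousOn z (Ici 0))
    (hz : ∀ t, 0 ≤ t → HasDerivWithinAt z (a * z (q * t) + b * z t + g t) (Ici t) t)
    (hg : g =o[atTop] γ) : z =o[atTop] γ := by
  have hO := isBigO_of_pantograph hq hb hρ0 hρ hγ hslow hcontr hzc hz hg.isBigO
  obtain ⟨ε, hε, hbε, hr⟩ := exists_pos_exp_mul_div_lt_one hb hρ
  obtain ⟨T₀, hT₀, hsl⟩ := hslow ε hε
  obtain ⟨T₂, hT₂⟩ := eventually_atTop.1 hcontr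
  have hd : 0 < -b - ε := by linarith
  have hb' : 0 < -b := by linarith
  refine isLittleO_of_forall_eventually_le hγ (by positivity) hr hO fun C δ hC hδ hev => ?_
  obtain ⟨T₃, hT₃⟩ := eventually_atTop.1 hev
  -- Chosen so that the forcing contributes exactly `δ/2`; the other half absorbs the homogeneous
  -- part.
  set δ' := δ / 2 / (Real.exp ε / (-b - ε)) with hδ'
  have hδ'0 : 0 < δ' := by positivity
  obtain ⟨T₁, hT₁, hgK⟩ := (isLittleO_atTop_iff_forall_exists_forall_ge hγ).1 hg δ' hδ'0
  set T := max (max T₀ T₃ / q) (max T₁ T₂)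
  have hTT₁ : T₁ ≤ T := (le_max_left _ _).trans (le_max_right _ _)
  have hTT₂ : T₂ ≤ T := (le_max_right _ _).trans (le_max_right _ _)
  have hT : 0 ≤ T := hT₁.trans hTT₁
  have hTm : max T₀ T₃ ≤ q * T := by
    rw [mul_comm, ← div_le_iff₀ hq.1]; exact le_max_left _ _
  have hdecay : (fun t => Real.exp (b * (t - T)) * |z T|) =o[atTop] γ := by
    have h1 := (hslow.exp_mul_isLittleO hb hγ).const_mul_left (Real.exp (-(b * T)) * |z T|)
    refine h1.congr_left fun t => ?_
    rw [mul_sub, sub_eq_add_neg, Real.exp_add]; ring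
  obtain ⟨T₄, hT₄, hdec⟩ := (isLittleO_atTop_iff_forall_exists_forall_ge hγ).1 hdecay (δ / 2)
    (by positivity)
  filter_upwards [eventually_ge_atTop T, eventually_ge_atTop T₄] with t ht ht₄
  have h1 := abs_le_of_pantograph_of_forall_le hq hε hbε hρ0 hT ((le_max_left _ _).trans hTm)
    hγ hsl (fun s hs => hT₂ s (hTT₂.trans hs)) hzc hz ht hC
    (fun s hs => hT₃ s ((le_max_right _ _).trans (hTm.trans hs.1))) hδ'0.le
    (fun s hs => hgK s (hTT₁.trans hs))
  have h2 := (le_abs_self _).trans (hdec t ht₄)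
  have h3 : δ' * (Real.exp ε / (-b - ε)) = δ / 2 := by
    rw [hδ']; exact div_mul_cancel₀ _ (by positivity)
  have h4 : (C * (ρ * -b) + δ') * (Real.exp ε * γ t) / (-b - ε) =
      (ρ * -b * Real.exp ε / (-b - ε) * C + δ' * (Real.exp ε / (-b - ε))) * γ t := by ring
  rw [h4, h3] at h1
  linarith

/-! ### Moving integrals and the auxiliary equation -/

theorem exists_primitive_of_movingIntegral {f : ℝ → ℝ} (hf : ContinuousOn f (Ici 0)) :
    ∃ F : ℝ → ℝ, Continuous F ∧ (∀ t, 0 ≤ t → HasDerivWithinAt F (f t) (Ici t) t) ∧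
      ∀ θ t, 0 ≤ θ → 0 ≤ t → movingIntegral f θ t = F t - F (max (t - θ) 0) := by
  -- Extending `f` by the constant `f 0` gives a primitive differentiable on the whole line.
  have hc : Continuous fun s => f (max s 0) :=
    hf.comp_continuous (continuous_id.max continuous_const) fun s => mem_Ici.2 (le_max_right _ _)
  have hF : ∀ t, HasDerivAt (fun t => ∫ s in (0 : ℝ)..t, f (max s 0)) (f (max t 0)) t :=
    fun t => hc.integral_hasStrictDerivAt 0 t |>.hasDerivAt
  refine ⟨fun t => ∫ s in (0 : ℝ)..t, f (max s 0),
    continuous_iff_continuousAt.2 fun t => (hF t).continuousAt,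
    fun t ht => ?_, fun θ t hθ ht => ?_⟩
  · have := (hF t).hasDerivWithinAt (s := Ici t)
    rwa [max_eq_left ht] at this
  · rw [intervalIntegral.integral_interval_sub_left (hc.intervalIntegrable _ _)
      (hc.intervalIntegrable _ _), movingIntegral]
    refine intervalIntegral.integral_congr fun s hs => ?_
    have hle : max (t - θ) 0 ≤ t := max_le (by linarith) ht
    rw [uIcc_of_le hle] at hs
    rw [max_eq_left ((le_max_right _ _).trans hs.1)]

/-- `f_θ(t) = y(t) - y(t-θ) + ∫ y` over `[t-θ, t]`: three terms, each at most `D`. -/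
theorem abs_movingIntegral_le_of_auxiliary {f y : ℝ → ℝ} {t θ D : ℝ}
    (hf : ContinuousOn f (Ici 0)) (hyc : ContinuousOn y (Ici 0))
    (hy : ∀ t, 0 ≤ t → HasDerivWithinAt y (-y t + f t) (Ici t) t)
    (ht : 1 ≤ t) (hθ : θ ∈ Icc (0 : ℝ) 1) (hD : ∀ s ∈ Icc (t - 1) t, |y s| ≤ D) :
    |movingIntegral f θ t| ≤ 3 * D := by
  obtain ⟨F, hFc, hF, hFm⟩ := exists_primitive_of_movingIntegral hf
  rw [hFm θ t hθ.1 (by linarith), max_eq_left (by linarith [hθ.2])]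
  have hle : t - θ ≤ t := by linarith [hθ.1]
  have hle1 : t - 1 ≤ t - θ := by linarith [hθ.2]
  have h1 := norm_image_sub_le_of_norm_deriv_right_le_segment (f := fun s => F s - y s)
    (f' := y) (C := D) (a := t - θ) (b := t)
    (hFc.continuousOn.sub (hyc.mono fun s hs => by
      have := hs.1; simp only [mem_Ici]; linarith))
    (fun s hs => by
      have hs0 : 0 ≤ s := by linarith [hs.1]
      exact ((hF s hs0).sub (hy s hs0)).congr_deriv (by ring))
    (fun s hs => hD s ⟨hle1.trans hs.1, hs.2.le⟩) t (right_mem_Icc.2 hle)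
  rw [Real.norm_eq_abs, sub_sub_cancel] at h1
  have h2 := hD t ⟨by linarith, le_rfl⟩
  have h3 := hD (t - θ) ⟨hle1, hle⟩
  have hD0 : 0 ≤ D := (abs_nonneg _).trans h2
  have h4 : D * θ ≤ D := mul_le_of_le_one_right hD0 hθ.2
  rw [abs_le] at *
  constructor <;> linarith [h1.1, h1.2, h2.1, h2.2, h3.1, h3.2]

/-- For fixed `t`, `z(s) = y(s) + F(t) - F(s)` satisfies `z' = -z + (F(t) - F(s))`, so `f` enters
only through moving integrals ending at `t`, and `z(t) = y(t)`. One `D` comes from `z(t-1)`, the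
other from the forcing. -/
theorem abs_auxiliary_le_of_movingIntegral {f y : ℝ → ℝ} {t D : ℝ}
    (hf : ContinuousOn f (Ici 0)) (hyc : ContinuousOn y (Ici 0))
    (hy : ∀ t, 0 ≤ t → HasDerivWithinAt y (-y t + f t) (Ici t) t)
    (ht : 1 ≤ t) (hD : ∀ θ ∈ Icc (0 : ℝ) 1, |movingIntegral f θ t| ≤ D) :
    |y t| ≤ Real.exp (-1) * |y (t - 1)| + 2 * D := by
  obtain ⟨F, hFc, hF, hFm⟩ := exists_primitive_of_movingIntegral hf
  have hFD : ∀ s ∈ Icc (t - 1) t, |F t - F s| ≤ D := by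
    intro s hs
    have h1 := hD (t - s) ⟨by linarith [hs.2], by linarith [hs.1]⟩
    rwa [hFm _ t (by linarith [hs.2]) (by linarith), sub_sub_cancel,
      max_eq_left (by linarith [hs.1])] at h1
  have hD0 : 0 ≤ D := (abs_nonneg _).trans (hFD t ⟨by linarith, le_rfl⟩)
  have h1 := abs_le_of_hasDerivWithinAt_damped (z := fun s => y s + (F t - F s))
    (h := fun s => F t - F s) (b := -1) (ε := 0) (D := D) (T := t - 1) (t := t) (by norm_num)
    (by linarith)
    ((hyc.mono fun s hs => by have := hs.1; simp only [mem_Ici]; linarith).add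
      (continuousOn_const.sub hFc.continuousOn))
    (fun s hs => by
      have hs0 : 0 ≤ s := by linarith [hs.1]
      exact ((hy s hs0).add ((hF s hs0).const_sub (F t))).congr_deriv (by ring))
    (fun s hs => by simpa using hFD s ⟨hs.1, hs.2.le⟩) hD0
  have h2 := hFD (t - 1) ⟨le_rfl, by linarith⟩
  have h3 : |y (t - 1) + (F t - F (t - 1))| ≤ |y (t - 1)| + D :=
    (abs_add_le _ _).trans (by linarith)
  have h4 : Real.exp (-1) ≤ 1 := Real.exp_le_one_iff.2 (by norm_num)
  simp only [sub_self, add_zero, sub_sub_cancel, neg_neg, sub_zero, div_one, mul_one] at h1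
  have h5 := mul_le_mul_of_nonneg_left h3 (Real.exp_pos (-1)).le
  nlinarith [Real.exp_pos (-1)]

/-- `sup_{0 ≤ θ ≤ 1} |f_θ(t)| = o(γ(t))` as `t → ∞`. -/
def MovingIntegralUniformLittleO (f γ : ℝ → ℝ) : Prop :=
  ∀ δ : ℝ, 0 < δ → ∃ T : ℝ, 0 ≤ T ∧
    ∀ t, T ≤ t → ∀ θ ∈ Icc (0 : ℝ) 1, |movingIntegral f θ t| ≤ δ * γ t

theorem exists_shift_bound_of_slowDecay {γ : ℝ → ℝ} (hγ : ∀ t, 0 ≤ t → 0 < γ t)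
    (hslow : SlowDecay γ) :
    ∃ C : ℝ, 0 < C ∧ ∃ T : ℝ, 0 ≤ T ∧ ∀ s t, T ≤ s → s ≤ t → t ≤ s + 1 → γ s ≤ C * γ t := by
  obtain ⟨T, hT, h⟩ := hslow 1 one_pos
  refine ⟨Real.exp 2, Real.exp_pos _, T, hT, fun s t hs hst hts => (h s t hs hst).trans ?_⟩
  have := hγ t (hT.trans (hs.trans hst))
  gcongr
  linarith

theorem movingIntegralBigO_of_auxiliary {f y γ : ℝ → ℝ} (hγ : ∀ t, 0 ≤ t → 0 < γ t)
    (hslow : SlowDecay γ) (hf : ContinuousOn f (Ici 0)) (hyc : ContinuousOn y (Ici 0))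
    (hy : ∀ t, 0 ≤ t → HasDerivWithinAt y (-y t + f t) (Ici t) t) (hO : y =O[atTop] γ) :
    MovingIntegralBigO f γ := by
  obtain ⟨C, hC, T₀, hT₀, hsh⟩ := exists_shift_bound_of_slowDecay hγ hslow
  obtain ⟨K, hK, T₁, hT₁, hyK⟩ := (isBigO_atTop_iff_exists_forall_ge hγ).1 hO
  refine ⟨max T₀ T₁ + 1, by positivity, 3 * (K * C), by positivity, fun t ht θ hθ => ?_⟩
  have h0 : T₀ ≤ t - 1 := by linarith [le_max_left T₀ T₁]
  have h1 : T₁ ≤ t - 1 := by linarith [le_max_right T₀ T₁]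
  rw [mul_assoc]
  refine abs_movingIntegral_le_of_auxiliary hf hyc hy (by linarith) hθ fun s hs => ?_
  rw [mul_assoc]
  exact (hyK s (h1.trans hs.1)).trans
    (mul_le_mul_of_nonneg_left (hsh s t (h0.trans hs.1) hs.2 (by linarith [hs.1])) hK.le)

theorem movingIntegralUniformLittleO_of_auxiliary {f y γ : ℝ → ℝ}
    (hγ : ∀ t, 0 ≤ t → 0 < γ t) (hslow : SlowDecay γ) (hf : ContinuousOn f (Ici 0))
    (hyc : ContinuousOn y (Ici 0))
    (hy : ∀ t, 0 ≤ t → HasDerivWithinAt y (-y t + f t) (Ici t) t) (ho : y =o[atTop] γ) :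
    MovingIntegralUniformLittleO f γ := by
  intro δ hδ
  obtain ⟨C, hC, T₀, hT₀, hsh⟩ := exists_shift_bound_of_slowDecay hγ hslow
  obtain ⟨T₁, hT₁, hyK⟩ := (isLittleO_atTop_iff_forall_exists_forall_ge hγ).1 ho
    (δ / (3 * C)) (by positivity)
  refine ⟨max T₀ T₁ + 1, by positivity, fun t ht θ hθ => ?_⟩
  have h0 : T₀ ≤ t - 1 := by linarith [le_max_left T₀ T₁]
  have h1 : T₁ ≤ t - 1 := by linarith [le_max_right T₀ T₁]
  have h2 := abs_movingIntegral_le_of_auxiliary (D := δ / (3 * C) * (C * γ t)) hf hyc hy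
    (by linarith) hθ fun s hs => (hyK s (h1.trans hs.1)).trans
      (mul_le_mul_of_nonneg_left (hsh s t (h0.trans hs.1) hs.2 (by linarith [hs.1]))
        (by positivity))
  refine h2.trans_eq ?_
  field_simp

theorem exp_neg_one_mul_exp_half_lt_one : Real.exp (-1) * Real.exp (1 / 2) < 1 := by
  rw [← Real.exp_add, Real.exp_lt_one_iff]; norm_num

theorem auxiliary_isBigO_of_movingIntegral {f y γ : ℝ → ℝ} (hγ : ∀ t, 0 ≤ t → 0 < γ t)
    (hslow : SlowDecay γ) (hf : ContinuousOn f (Ici 0)) (hyc : ContinuousOn y (Ici 0))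
    (hy : ∀ t, 0 ≤ t → HasDerivWithinAt y (-y t + f t) (Ici t) t)
    (hA : MovingIntegralBigO f γ) : y =O[atTop] γ := by
  obtain ⟨T₁, hT₁, K, hK, hfK⟩ := hA
  -- Rate `1/4` costs `e^{1/2}` over a unit step, which the damping `e⁻¹` outweighs.
  obtain ⟨T₀, hT₀, hsl⟩ := hslow (1 / 4) (by norm_num)
  set T := max T₀ T₁
  have h0 : T₀ ≤ T := le_max_left _ _
  have h1 : T₁ ≤ T := le_max_right _ _
  have hT : 0 ≤ T := hT₀.trans h0
  have hbdd := bddAbove_image_abs_div_of_slowDecay (by norm_num) hT hγ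
    (fun s t hs => hsl s t (h0.trans hs)) hyc
  obtain ⟨M, hM⟩ := hbdd (T + 1)
  have hM' : ∀ s ∈ Icc T (T + 1), |y s| / γ s ≤ M := fun s hs => hM ⟨s, hs, rfl⟩
  have hM0 : 0 ≤ M :=
    (div_nonneg (abs_nonneg _) (hγ T hT).le).trans (hM' T ⟨le_rfl, by linarith⟩)
  set r := Real.exp (-1) * Real.exp (1 / 2)
  have hr0 : 0 ≤ r := by positivity
  have hfin := le_div_of_forall_le_add_mul_of_bddAbove (φ := fun s => |y s| / γ s) (T := T)
    (A := M + 2 * K) exp_neg_one_mul_exp_half_lt_one (fun t _ => hbdd t) (fun t ht S hS => by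
      have hS0 : 0 ≤ S := (div_nonneg (abs_nonneg _) (hγ _ hT).le).trans
        (hS _ (left_mem_Icc.2 ht))
      rcases le_total t (T + 1) with htT | htT
      · have h1 := hM' t ⟨ht, htT⟩
        have h2 := mul_nonneg hr0 hS0
        linarith
      · have hγt := hγ t (hT.trans ht)
        have h2 := abs_auxiliary_le_of_movingIntegral hf hyc hy (by linarith)
          (hfK t (h1.trans ht))
        have h3 : |y (t - 1)| ≤ S * γ (t - 1) :=
          (div_le_iff₀ (hγ _ (by linarith))).1 (hS (t - 1) ⟨by linarith, by linarith⟩)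
        have h4 := hsl (t - 1) t (by linarith) (by linarith)
        rw [show 1 / 4 * (t - (t - 1)) + 1 / 4 = (1 / 2 : ℝ) by ring] at h4
        rw [div_le_iff₀ hγt]
        calc |y t| ≤ Real.exp (-1) * |y (t - 1)| + 2 * (K * γ t) := h2
          _ ≤ Real.exp (-1) * (S * (Real.exp (1 / 2) * γ t)) + 2 * (K * γ t) := by
              gcongr
              exact h3.trans (mul_le_mul_of_nonneg_left h4 hS0)
          _ = (2 * K + r * S) * γ t := by ring
          _ ≤ (M + 2 * K + r * S) * γ t := by gcongr; linarith)
  refine IsBigO.of_bound ((M + 2 * K) / (1 - r)) ?_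
  filter_upwards [eventually_ge_atTop T] with t ht
  have hγt := hγ t (hT.trans ht)
  rw [Real.norm_eq_abs, Real.norm_eq_abs, abs_of_pos hγt]
  exact (div_le_iff₀ hγt).1 (hfin t ht)

theorem MovingIntegralUniformLittleO.bigO {f γ : ℝ → ℝ} (h : MovingIntegralUniformLittleO f γ) :
    MovingIntegralBigO f γ := by
  obtain ⟨T, hT, hf⟩ := h 1 one_pos
  exact ⟨T, hT, 1, one_pos, hf⟩

theorem auxiliary_isLittleO_of_movingIntegral {f y γ : ℝ → ℝ} (hγ : ∀ t, 0 ≤ t → 0 < γ t)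
    (hslow : SlowDecay γ) (hf : ContinuousOn f (Ici 0)) (hyc : ContinuousOn y (Ici 0))
    (hy : ∀ t, 0 ≤ t → HasDerivWithinAt y (-y t + f t) (Ici t) t)
    (hA : MovingIntegralUniformLittleO f γ) : y =o[atTop] γ := by
  refine isLittleO_of_forall_eventually_le hγ (by positivity) exp_neg_one_mul_exp_half_lt_one
    (auxiliary_isBigO_of_movingIntegral hγ hslow hf hyc hy hA.bigO) fun C δ hC hδ hev => ?_
  obtain ⟨T₁, hT₁, hfK⟩ := hA (δ / 2) (by positivity)
  obtain ⟨T₀, hT₀, hsl⟩ := hslow (1 / 4) (by norm_num)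
  obtain ⟨T₂, hT₂⟩ := eventually_atTop.1 hev
  filter_upwards [eventually_ge_atTop T₁, eventually_ge_atTop (T₀ + 1),
    eventually_ge_atTop (T₂ + 1)] with t h1 h0 h2
  have h3 := abs_auxiliary_le_of_movingIntegral hf hyc hy (by linarith) (hfK t h1)
  have h4 := hsl (t - 1) t (by linarith) (by linarith)
  rw [show 1 / 4 * (t - (t - 1)) + 1 / 4 = (1 / 2 : ℝ) by ring] at h4
  calc |y t| ≤ Real.exp (-1) * |y (t - 1)| + 2 * (δ / 2 * γ t) := h3
    _ ≤ Real.exp (-1) * (C * (Real.exp (1 / 2) * γ t)) + 2 * (δ / 2 * γ t) := by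
        gcongr
        exact (hT₂ _ (by linarith)).trans (mul_le_mul_of_nonneg_left h4 hC)
    _ = _ := by ring

/-- Pointwise smallness of the moving integrals is automatically uniform in `θ ∈ [0, 1]`. -/
theorem MovingIntegralLittleO.uniform {f γ : ℝ → ℝ} (hγ : ∀ t, 0 ≤ t → 0 < γ t)
    (hslow : SlowDecay γ) (hf : ContinuousOn f (Ici 0)) (h : MovingIntegralLittleO f γ) :
    MovingIntegralUniformLittleO f γ := by
  obtain ⟨F, hFc, -, hFm⟩ := exists_primitive_of_movingIntegral hf
  obtain ⟨C, hC, T₀, hT₀, hsh⟩ := exists_shift_bound_of_slowDecay hγ hslow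
  have hpt : ∀ θ ∈ Icc (0 : ℝ) 1, ∀ ε : ℝ, 0 < ε →
      ∃ n : ℕ, ∀ t, (n : ℝ) + 1 ≤ t → |F t - F (t - θ)| ≤ ε * γ t := by
    intro θ hθ ε hε
    obtain ⟨T, hT, hle⟩ := (isLittleO_atTop_iff_forall_exists_forall_ge hγ).1 (h θ hθ) ε hε
    obtain ⟨n, hn⟩ := exists_nat_ge T
    refine ⟨n, fun t ht => ?_⟩
    have ht1 : 1 ≤ t := by linarith [n.cast_nonneg (α := ℝ)]
    have := hle t (by linarith)
    rwa [hFm θ t hθ.1 (by linarith), max_eq_left (by linarith [hθ.2])] at this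
  intro δ hδ
  set ε := δ / (1 + (1 + C) * C) with hε_def
  have hε : 0 < ε := by positivity
  -- Baire: these closed sets of parameters sharing one threshold cover `[0,1]`, so one has
  -- interior.
  set E : ℕ → Set (Icc (0 : ℝ) 1) :=
    fun n => {θ | ∀ t, (n : ℝ) + 1 ≤ t → |F t - F (t - θ)| ≤ ε * γ t}
  have hclosed : ∀ n, IsClosed (E n) := by
    intro n
    simp only [E, ofPred_forall]
    refine isClosed_iInter fun t => isClosed_iInter fun _ => isClosed_le ?_ continuous_const
    fun_prop
  have hcover : ⋃ n, E n = univ := by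
    refine eq_univ_of_forall fun θ => ?_
    obtain ⟨n, hn⟩ := hpt θ θ.2 ε hε
    exact mem_iUnion.2 ⟨n, hn⟩
  obtain ⟨n, x, hx⟩ := nonempty_interior_of_iUnion_of_closed hclosed hcover
  -- a non-degenerate interval of good parameters
  obtain ⟨α, l, hα, hl, hgood⟩ : ∃ α l : ℝ, 0 ≤ α ∧ 0 < l ∧
      ∀ θ ∈ Icc α (α + l), θ ≤ 1 ∧ ∀ t, (n : ℝ) + 1 ≤ t → |F t - F (t - θ)| ≤ ε * γ t := by
    rw [mem_interior_iff_mem_nhds, Metric.mem_nhds_iff] at hx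
    obtain ⟨d, hd, hball⟩ := hx
    have hmem : ∀ θ : ℝ, ∀ h0 : θ ∈ Icc (0 : ℝ) 1, |θ - x| < d →
        ∀ t, (n : ℝ) + 1 ≤ t → |F t - F (t - θ)| ≤ ε * γ t := by
      intro θ h0 hθ
      have h1 : (⟨θ, h0⟩ : Icc (0 : ℝ) 1) ∈ E n := hball (by
        rw [Metric.mem_ball, Subtype.dist_eq, Real.dist_eq]; exact hθ)
      exact h1
    have hx0 := x.2.1
    have hx1 := x.2.2
    set l := min (d / 2) (1 / 2)
    have hl0 : 0 < l := by positivity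
    have hl1 : l ≤ d / 2 := min_le_left _ _
    have hl2 : l ≤ 1 / 2 := min_le_right _ _
    rcases le_total (x : ℝ) (1 / 2) with hx2 | hx2
    · refine ⟨x, l, hx0, hl0, fun θ hθ => ⟨by linarith [hθ.2], ?_⟩⟩
      refine hmem θ ⟨hx0.trans hθ.1, by linarith [hθ.2]⟩ ?_
      rw [abs_lt]; constructor <;> linarith [hθ.1, hθ.2]
    · refine ⟨x - l, l, by linarith, hl0, fun θ hθ => ⟨by linarith [hθ.2], ?_⟩⟩
      refine hmem θ ⟨by linarith [hθ.1], by linarith [hθ.2]⟩ ?_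
      rw [abs_lt]; constructor <;> linarith [hθ.1, hθ.2]
  -- uniformity for small `θ`
  have hsmall : ∀ t θ, max T₀ n + 2 ≤ t → 0 ≤ θ → θ ≤ l → θ ≤ 1 →
      |F t - F (t - θ)| ≤ ε * (1 + C) * γ t := by
    intro t θ ht hθ0 hθl hθ1
    have ht0 : T₀ + 2 ≤ t := by linarith [le_max_left T₀ (n : ℝ)]
    have htn : (n : ℝ) + 2 ≤ t := by linarith [le_max_right T₀ (n : ℝ)]
    have h1 := (hgood (α + θ) ⟨by linarith, by linarith⟩).2 t (by linarith)
    have h2 := (hgood α ⟨le_rfl, by linarith⟩).2 (t - θ) (by linarith)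
    have h3 := mul_le_mul_of_nonneg_left
      (hsh (t - θ) t (by linarith) (by linarith) (by linarith)) hε.le
    rw [show t - θ - α = t - (α + θ) by ring] at h2
    -- A short increment is the difference of two good ones: parameter `α + θ` at `t` and `α` at `t
    -- - θ`.
    have h4 : F t - F (t - θ) =
      (F t - F (t - (α + θ))) - (F (t - θ) - F (t - (α + θ))) := by ring
    rw [h4]
    calc _ ≤ |F t - F (t - (α + θ))| + |F (t - θ) - F (t - (α + θ))| := abs_sub _ _
      _ ≤ ε * γ t + ε * (C * γ t) := by linarith
      _ = _ := by ring
  -- Write `θ = j l` plus a remainder below `l`. Only finitely many multiples `j l` occur; the sum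
  -- `R` dominates all their thresholds.
  choose! N hN using fun θ hθ => hpt θ hθ ε hε
  set J := ⌊1 / l⌋₊
  set R : ℝ := ∑ j ∈ Finset.range (J + 1), (N (j * l) : ℝ)
  have hR : ∀ j, j ≤ J → (N (j * l) : ℝ) ≤ R := fun j hj =>
    Finset.single_le_sum (f := fun j : ℕ => (N (j * l) : ℝ)) (fun _ _ => Nat.cast_nonneg _)
      (Finset.mem_range.2 (Nat.lt_succ_of_le hj))
  have hR0 : 0 ≤ R := Finset.sum_nonneg fun _ _ => Nat.cast_nonneg _
  refine ⟨max T₀ n + 3 + R, by positivity, fun t ht θ hθ => ?_⟩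
  have ht0 : T₀ + 3 + R ≤ t := by linarith [le_max_left T₀ (n : ℝ)]
  rw [hFm θ t hθ.1 (by linarith), max_eq_left (by linarith [hθ.2])]
  set j := ⌊θ / l⌋₊
  have hj1 : j * l ≤ θ := by
    rw [← le_div_iff₀ hl]; exact Nat.floor_le (div_nonneg hθ.1 hl.le)
  have hj2 : θ < (j + 1) * l := by
    rw [← div_lt_iff₀ hl]; exact Nat.lt_floor_add_one _
  have hjJ : j ≤ J := Nat.floor_le_floor (by gcongr; exact hθ.2)
  have hj0 : 0 ≤ j * l := by positivity
  have hjl1 : j * l ≤ 1 := hj1.trans hθ.2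
  have h1 := hN (j * l) ⟨hj0, hjl1⟩ t (by linarith [hR j hjJ])
  have h2 := hsmall (t - j * l) (θ - j * l) (by linarith) (by linarith) (by linarith)
    (by linarith [hθ.2])
  rw [show t - j * l - (θ - j * l) = t - θ by ring] at h2
  have h3 := mul_le_mul_of_nonneg_left
    (hsh (t - j * l) t (by linarith) (by linarith) (by linarith))
    (show 0 ≤ ε * (1 + C) by positivity)
  calc |F t - F (t - θ)| = |(F t - F (t - j * l)) + (F (t - j * l) - F (t - θ))| := by
        congr 1; ring
    _ ≤ |F t - F (t - j * l)| + |F (t - j * l) - F (t - θ)| := abs_add_le _ _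
    _ ≤ ε * γ t + ε * (1 + C) * (C * γ t) := by linarith
    _ = ε * (1 + (1 + C) * C) * γ t := by ring
    _ = δ * γ t := by rw [hε_def, div_mul_cancel₀ _ (by positivity)]

theorem MovingIntegralUniformLittleO.littleO {f γ : ℝ → ℝ} (hγ : ∀ t, 0 ≤ t → 0 < γ t)
    (h : MovingIntegralUniformLittleO f γ) : MovingIntegralLittleO f γ := fun θ hθ =>
  (isLittleO_atTop_iff_forall_exists_forall_ge hγ).2 fun δ hδ =>
    let ⟨T, hT, hle⟩ := h δ hδ
    ⟨T, hT, fun t ht => hle t ht θ hθ⟩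

/-- On `[0,T]` the moving integrals are at most `sup |f|`, and the lower bound on `γ` turns this
into a multiple of `γ`. -/
theorem MovingIntegralBigO.boundFrom_zero {f γ : ℝ → ℝ} (hf : ContinuousOn f (Ici 0))
    (hγ : ∀ T : ℝ, ∃ m : ℝ, 0 < m ∧ ∀ t ∈ Icc (0 : ℝ) T, m ≤ γ t)
    (h : MovingIntegralBigO f γ) : MovingIntegralBoundFrom 0 f γ := by
  obtain ⟨T, hT, K, hK, hle⟩ := h
  obtain ⟨m, hm, hmγ⟩ := hγ T
  obtain ⟨B, hB⟩ := (isCompact_Icc (a := (0 : ℝ)) (b := T)).exists_bound_of_continuousOn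
    (hf.mono fun s hs => hs.1)
  have hB0 : 0 ≤ B := (norm_nonneg _).trans (hB 0 ⟨le_rfl, hT⟩)
  refine ⟨K + B / m, by positivity, fun t ht θ hθ => ?_⟩
  rcases le_total T t with htT | htT
  · have hγt : 0 < γ t := by
      obtain ⟨m', hm', hle'⟩ := hγ t
      exact hm'.trans_le (hle' t ⟨ht, le_rfl⟩)
    exact (hle t htT θ hθ).trans
      (mul_le_mul_of_nonneg_right (by linarith [div_nonneg hB0 hm.le]) hγt.le)
  · have hle' : max (t - θ) 0 ≤ t := max_le (by linarith [hθ.1]) ht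
    have h1 : |movingIntegral f θ t| ≤ B * |t - max (t - θ) 0| := by
      refine intervalIntegral.norm_integral_le_of_norm_le_const (f := f) fun s hs => ?_
      rw [uIoc_of_le hle'] at hs
      exact hB s ⟨(le_max_right _ _).trans hs.1.le, hs.2.trans htT⟩
    have h2 : |t - max (t - θ) 0| ≤ 1 := by
      rw [abs_of_nonneg (by linarith)]
      linarith [le_max_left (t - θ) 0, hθ.2]
    have hmt := hmγ t ⟨ht, htT⟩
    calc |movingIntegral f θ t| ≤ B * 1 := h1.trans (mul_le_mul_of_nonneg_left h2 hB0)
      _ = B / m * m := by field_simp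
      _ ≤ (K + B / m) * γ t := by gcongr; linarith

/-! ### The upper limit of the ratio -/

theorem limsupRatio_lt_top_iff {u γ : ℝ → ℝ} (hγ : ∀ t, 0 ≤ t → 0 < γ t) :
    limsupRatio u γ < ⊤ ↔ u =O[atTop] γ := by
  rw [isBigO_atTop_iff_exists_forall_ge hγ, limsupRatio]
  constructor
  · intro h
    obtain ⟨K, hK, -⟩ := EReal.lt_iff_exists_real_btwn.1 h
    obtain ⟨T, hT⟩ := eventually_atTop.1 (eventually_lt_of_limsup_lt hK)
    refine ⟨max K 1, by positivity, max T 0, le_max_right _ _, fun t ht => ?_⟩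
    have hγt := hγ t ((le_max_right _ _).trans ht)
    have h1 := EReal.coe_lt_coe_iff.1 (hT t ((le_max_left _ _).trans ht))
    rw [div_lt_iff₀ hγt] at h1
    exact h1.le.trans (mul_le_mul_of_nonneg_right (le_max_left _ _) hγt.le)
  · rintro ⟨K, -, T, hT, hu⟩
    refine (limsup_le_of_le (a := (K : EReal)) ?_ ?_).trans_lt (EReal.coe_lt_top K)
    · isBoundedDefault
    · filter_upwards [eventually_ge_atTop T] with t ht
      exact EReal.coe_le_coe_iff.2 ((div_le_iff₀ (hγ t (hT.trans ht))).2 (hu t ht))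

theorem limsupRatio_pos_iff {u γ : ℝ → ℝ} (hγ : ∀ t, 0 ≤ t → 0 < γ t) :
    0 < limsupRatio u γ ↔ ¬ u =o[atTop] γ := by
  rw [← not_le, not_iff_not, isLittleO_atTop_iff_forall_exists_forall_ge hγ, limsupRatio]
  constructor
  · intro h δ hδ
    have h1 := eventually_lt_of_limsup_lt (h.trans_lt (EReal.coe_pos.2 hδ))
    obtain ⟨T, hT⟩ := eventually_atTop.1 h1
    refine ⟨max T 0, le_max_right _ _, fun t ht => ?_⟩
    have hγt := hγ t ((le_max_right _ _).trans ht)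
    have h2 := EReal.coe_lt_coe_iff.1 (hT t ((le_max_left _ _).trans ht))
    exact ((div_lt_iff₀ hγt).1 h2).le
  · intro h
    refine EReal.le_of_forall_lt_iff_le.1 fun δ hδ => ?_
    obtain ⟨T, hT, hu⟩ := h δ (EReal.coe_pos.1 hδ)
    refine limsup_le_of_le ?_ ?_
    · isBoundedDefault
    · filter_upwards [eventually_ge_atTop T] with t ht
      exact EReal.coe_le_coe_iff.2 ((div_le_iff₀ (hγ t (hT.trans ht))).2 (hu t ht))

theorem limsupRatio_mem_Ioo_iff {u γ : ℝ → ℝ} (hγ : ∀ t, 0 ≤ t → 0 < γ t) :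
    limsupRatio u γ ∈ Ioo (0 : EReal) ⊤ ↔ u =O[atTop] γ ∧ ¬ u =o[atTop] γ := by
  rw [mem_Ioo, limsupRatio_lt_top_iff hγ, limsupRatio_pos_iff hγ, and_comm]

theorem exists_limsupRatio_movingIntegral_pos_iff {f γ : ℝ → ℝ} (hγ : ∀ t, 0 ≤ t → 0 < γ t) :
    (∃ θ ∈ Ioc (0 : ℝ) 1, 0 < limsupRatio (movingIntegral f θ) γ) ↔
      ¬ MovingIntegralLittleO f γ := by
  simp only [limsupRatio_pos_iff hγ, MovingIntegralLittleO]
  push Not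
  constructor
  · rintro ⟨θ, hθ, h⟩
    exact ⟨θ, Ioc_subset_Icc_self hθ, h⟩
  · rintro ⟨θ, hθ, h⟩
    refine ⟨θ, ⟨hθ.1.lt_of_ne ?_, hθ.2⟩, h⟩
    -- The excluded parameter `θ = 0` is harmless: its moving integral vanishes.
    rintro rfl
    refine h ((isLittleO_zero γ atTop).congr' ?_ EventuallyEq.rfl)
    filter_upwards [eventually_ge_atTop 0] with t ht
    simp [movingIntegral, max_eq_left ht]

/-! ### Comparison of the two equations and conclusion -/

theorem comp_mul_isBigO_self {q : ℝ} {γ : ℝ → ℝ} (hq : q ∈ Ioo (0 : ℝ) 1)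
    (hγ : (∃ η : ℝ, IsRegularlyVarying η γ) ∨ IsIncreasingUnboundedWeight γ) :
    (fun t => γ (q * t)) =O[atTop] γ := by
  rcases hγ with ⟨η, hpos, -, hlim⟩ | ⟨hpos, hmono, -⟩
  · refine isBigO_of_div_tendsto_nhds ?_ _ (hlim q hq.1)
    filter_upwards [eventually_ge_atTop 0] with t ht h0
    exact absurd h0 (hpos t ht).ne'
  · refine IsBigO.of_bound 1 ?_
    filter_upwards [eventually_ge_atTop 0] with t ht
    have hqt : 0 ≤ q * t := mul_nonneg hq.1.le ht
    rw [one_mul, Real.norm_eq_abs, Real.norm_eq_abs, abs_of_pos (hpos _ hqt),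
      abs_of_pos (hpos t ht)]
    exact hmono hqt ht (by nlinarith [hq.2])

theorem mainTheorem6 (a b q ζ : ℝ) (f x y γ : ℝ → ℝ)
    (hq : q ∈ Ioo (0 : ℝ) 1) (ha : a ≠ 0) (hb : b < 0) (hab : |a| < |b|)
    (hf : ContinuousOn f (Ici 0))
    (hx : IsPantographSolution a b q f ζ x) (hy : IsAuxiliarySolution f y)
    (hγ : (∃ η : ℝ, pantographExponent a b q < η ∧ IsRegularlyVarying η γ) ∨
      IsIncreasingUnboundedWeight γ) :
    -- (I)
    ((MovingIntegralBigO f γ ↔ y =O[atTop] γ) ∧ (y =O[atTop] γ ↔ x =O[atTop] γ)) ∧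
    -- (II)
    ((MovingIntegralLittleO f γ ↔ y =o[atTop] γ) ∧ (y =o[atTop] γ ↔ x =o[atTop] γ)) ∧
    -- (III)
    (((MovingIntegralBigO f γ ∧ ∃ θ ∈ Ioc (0 : ℝ) 1, 0 < limsupRatio (movingIntegral f θ) γ) ↔
        limsupRatio y γ ∈ Ioo (0 : EReal) ⊤) ∧
      (limsupRatio y γ ∈ Ioo (0 : EReal) ⊤ ↔ limsupRatio x γ ∈ Ioo (0 : EReal) ⊤)) ∧
    -- the bound may be required for all `t ≥ 0` if `γ` is locally bounded away from zero
    ((∀ T : ℝ, ∃ m : ℝ, 0 < m ∧ ∀ t ∈ Icc (0 : ℝ) T, m ≤ γ t) →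
      (MovingIntegralBigO f γ ↔ MovingIntegralBoundFrom 0 f γ)) := by
  have hpos : ∀ t, 0 ≤ t → 0 < γ t := by
    rcases hγ with ⟨η, -, h⟩ | h
    exacts [h.1, h.1]
  have hslow : SlowDecay γ := by
    rcases hγ with ⟨η, -, h⟩ | h
    exacts [h.slowDecay, h.slowDecay]
  obtain ⟨ρ, hρ0, hρ, hcontr⟩ :
      ∃ ρ : ℝ, 0 ≤ ρ ∧ ρ < 1 ∧ ∀ᶠ t in atTop, |a| * γ (q * t) ≤ ρ * -b * γ t := by
    rcases hγ with ⟨η, hη, h⟩ | h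
    exacts [h.exists_delay_contraction hq ha hb hη, h.exists_delay_contraction hq hb hab]
  have hdelay : (fun t => γ (q * t)) =O[atTop] γ :=
    comp_mul_isBigO_self hq (hγ.imp_left fun ⟨η, _, h⟩ => ⟨η, h⟩)
  have hqt : Tendsto (fun t => q * t) atTop atTop := tendsto_id.const_mul_atTop hq.1
  have hyc : ContinuousOn y (Ici 0) := fun t ht => (hy.2 t ht).continuousWithinAt
  have hxc : ContinuousOn x (Ici 0) := fun t ht => (hx.2 t ht).continuousWithinAt
  have hyd : ∀ t, 0 ≤ t → HasDerivWithinAt y (-y t + f t) (Ici t) t :=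
    fun t ht => (hy.2 t ht).mono (Ici_subset_Ici.2 ht)
  have hxd : ∀ t, 0 ≤ t → HasDerivWithinAt x (a * x (q * t) + b * x t + f t) (Ici t) t :=
    fun t ht => (hx.2 t ht).mono (Ici_subset_Ici.2 ht)
  have hxy : ∀ t, 0 ≤ t → HasDerivWithinAt (fun t => x t - y t)
      (a * (x (q * t) - y (q * t)) + b * (x t - y t) + (a * y (q * t) + (b + 1) * y t))
      (Ici t) t :=
    fun t ht => ((hxd t ht).sub (hyd t ht)).congr_deriv (by ring)
  -- A pantograph equation with coefficients `0` and `-1`, for which `ρ = 0` serves as contraction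
  -- factor.
  have hyx : ∀ t, 0 ≤ t → HasDerivWithinAt (fun t => y t - x t)
      (0 * (y (q * t) - x (q * t)) + -1 * (y t - x t) + (-a * x (q * t) + -(b + 1) * x t))
      (Ici t) t :=
    fun t ht => ((hyd t ht).sub (hxd t ht)).congr_deriv (by ring)
  have hcontr0 : ∀ᶠ t in atTop, |(0 : ℝ)| * γ (q * t) ≤ 0 * -(-1) * γ t := by simp
  have hO : y =O[atTop] γ ↔ x =O[atTop] γ := by
    constructor <;> intro h
    · have hg : (fun t => a * y (q * t) + (b + 1) * y t) =O[atTop] γ :=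
        (((h.comp_tendsto hqt).trans hdelay).const_mul_left a).add (h.const_mul_left _)
      simpa using (isBigO_of_pantograph hq hb hρ0 hρ hpos hslow hcontr (hxc.sub hyc) hxy hg).add h
    · have hg : (fun t => -a * x (q * t) + -(b + 1) * x t) =O[atTop] γ :=
        (((h.comp_tendsto hqt).trans hdelay).const_mul_left _).add (h.const_mul_left _)
      simpa using (isBigO_of_pantograph hq (by norm_num) le_rfl one_pos hpos hslow hcontr0
        (hyc.sub hxc) hyx hg).add h
  have ho : y =o[atTop] γ ↔ x =o[atTop] γ := by
    constructor <;> intro h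
    · have hg : (fun t => a * y (q * t) + (b + 1) * y t) =o[atTop] γ :=
        (((h.comp_tendsto hqt).trans_isBigO hdelay).const_mul_left a).add (h.const_mul_left _)
      simpa using
        (isLittleO_of_pantograph hq hb hρ0 hρ hpos hslow hcontr (hxc.sub hyc) hxy hg).add h
    · have hg : (fun t => -a * x (q * t) + -(b + 1) * x t) =o[atTop] γ :=
        (((h.comp_tendsto hqt).trans_isBigO hdelay).const_mul_left _).add (h.const_mul_left _)
      simpa using (isLittleO_of_pantograph hq (by norm_num) le_rfl one_pos hpos hslow hcontr0
        (hyc.sub hxc) hyx hg).add h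
  have hAO : MovingIntegralBigO f γ ↔ y =O[atTop] γ :=
    ⟨auxiliary_isBigO_of_movingIntegral hpos hslow hf hyc hyd,
      movingIntegralBigO_of_auxiliary hpos hslow hf hyc hyd⟩
  have hAo : MovingIntegralLittleO f γ ↔ y =o[atTop] γ :=
    ⟨fun h => auxiliary_isLittleO_of_movingIntegral hpos hslow hf hyc hyd
        (h.uniform hpos hslow hf),
      fun h => (movingIntegralUniformLittleO_of_auxiliary hpos hslow hf hyc hyd h).littleO hpos⟩
  refine ⟨⟨hAO, hO⟩, ⟨hAo, ho⟩, ⟨?_, ?_⟩, fun hloc =>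
    ⟨fun h => h.boundFrom_zero hf hloc, fun h => ⟨0, le_rfl, h⟩⟩⟩
  · rw [exists_limsupRatio_movingIntegral_pos_iff hpos, limsupRatio_mem_Ioo_iff hpos, hAO, hAo]
  · rw [limsupRatio_mem_Ioo_iff hpos, limsupRatio_mem_Ioo_iff hpos, hO, ho]
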